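/- **Conventions.** A variety is the class of all (nonempty) algebras of a given finitary signature that satisfy a given set of equations; it is congruence modular if every algebra in it has a modular congruence lattice. An admissible relation on an algebra is a reflexive binary relation compatible with all operations; a tolerance is a symmetric admissible relation, and a congruence is a transitive tolerance. For relations on an algebra, juxtaposition denotes intersection, $\circ$ denotes composition, $R\circ_m S$ denotes $R\circ S\circ R\circ\cdots$ with $m$ factors ($R\circ_0 S$ is the equality relation), and $R^h=R\circ_h R$. A variety satisfies an inclusion if the inclusion holds in each of its algebras for all values of the variables, where $\alpha,\beta,\gamma$ range over congruences, $R,S$ over admissible relations and $\Theta,\Psi$ over tolerances. Put $A_0(\beta,\gamma)=\alpha\beta$ and $A_{\ell+1}(\beta,\gamma)=\alpha(\beta\circ A_\ell(\gamma,\beta)\circ\beta)$, so that $A_1(\beta,\gamma)=\alpha(\beta\circ\alpha\gamma\circ\beta)$ and $A_2(\beta,\gamma)=\alpha(\beta\circ\alpha(\gamma\circ\alpha\beta\circ\gamma)\circ\beta)$. **The thirteen spectra.** For a variety $\mathcal V$, let each of the following be the least $k\in\{0,1,2,\dots\}$ such that $\mathcal V$ satisfies the stated inclusion (and $\infty$ if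 there is no such $k$): 1. $D_{\mathcal V}(m)$, $m\ge3$: $\ \alpha(\beta\circ_m\alpha\gamma)\subseteq\alpha\beta\circ_k\alpha\gamma$; 2. $D^{\smallsmile}_{\mathcal V}(m)$, $m\ge3$: $\ \alpha(\beta\circ_m\alpha\gamma)\subseteq\alpha\gamma\circ_k\alpha\beta$; 3. $D^*_{\mathcal V}(\ell)$, $\ell\ge1$: $\ A_\ell(\beta,\gamma)\subseteq\alpha\beta\circ_k\alpha\gamma$; 4. $T_{\mathcal V}(m)$, $m\ge2$: $\ \alpha(\beta\circ_m\gamma)\subseteq\alpha(\gamma\circ\beta)\circ(\alpha\gamma\circ_k\alpha\beta)$; 5. $T^{\smallsmile}_{\mathcal V}(m)$, $m\ge3$: $\ \alpha(\beta\circ_m\gamma)\subseteq\alpha(\beta\circ\gamma)\circ(\alpha\beta\circ_k\alpha\gamma)$; 6. $T^*_{\mathcal V}(m)$, $m\ge3$: $\ \alpha(\beta\circ_m\gamma)\subseteq\alpha(\gamma\circ\beta\circ\gamma)\circ(\alpha\beta\circ_k\alpha\gamma)$; 7. $T^{**}_{\mathcal V}(m)$, $m\ge3$: $\ \alpha(\beta\circ_m\gamma)\subseteq\alpha(\gamma\circ\beta\circ\gamma)\circ_k\alpha(\gamma\circ\beta\circ\gamma)$;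 8. $T^{r}_{\mathcal V}(m)$, $m\ge2$: $\ \alpha(R\circ_mS)\subseteq\alpha(S\circ R)\circ(\alpha S\circ_k\alpha R)$; 9. $T^{r\smallsmile}_{\mathcal V}(m)$, $m\ge3$: $\ \alpha(R\circ_mS)\subseteq\alpha(R\circ S)\circ(\alpha R\circ_k\alpha S)$; 10. $R_{\mathcal V}(m)$, $m\ge2$: $\ \alpha(R\circ_mR)\subseteq\alpha R\circ_k\alpha R$; 11. $D^{r}_{\mathcal V}(m)$, $m\ge3$: $\ \alpha(R\circ_m\alpha S)\subseteq\alpha R\circ_k\alpha S$; 12. $D^{r\smallsmile}_{\mathcal V}(m)$, $m\ge3$: $\ \alpha(R\circ_m\alpha S)\subseteq\alpha S\circ_k\alpha R$; 13. $C_{\mathcal V}(h,j)$, $h,j\ge1$: $\ \Theta^h\Psi^j\subseteq(\Theta\Psi)^k$. **Proposition.** (a) For each of the thirteen spectra, the set of the functions (with values in $\mathbb N$) that are the spectrum of some congruence modular variety is closed under pointwise maximum. (b) In detail, if $\mathcal V$ and $\mathcal V'$ are congruence modular varieties, then there is a congruence modular variety $\mathcal W$ such that $D_{\mathcal W}(m)=\max\{D_{\mathcal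 V}(m),D_{\mathcal V'}(m)\}$ for every $m\ge3$, and the same holds, with the same $\mathcal W$, for each of the other twelve spectra and all its arguments. (c) The set of those 13-tuples of functions (with values in $\mathbb N$) that are the 13-tuple $(D_{\mathcal V},\dots,C_{\mathcal V})$ of some congruence modular variety $\mathcal V$ is closed under componentwise pointwise maximum. -/

import Mathlib

universe u

namespace UnivAlg

section Relations

variable {A : Type u}

/-- Relational composition: `a (R ⨟ S) c` iff `a R b` and `b S c` for some `b`. -/
def comp (R S : A → A → Prop) : A → A → Prop := fun a c => ∃ b, R a b ∧ S b c

infixr:75 " ⨟ " => comp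

/-- `altComp R S m` is `R ⨟ S ⨟ R ⨟ ⋯` with `m` alternating factors, the first one being `R`.
For `m = 0` it is the equality relation. -/
def altComp (R S : A → A → Prop) : ℕ → A → A → Prop
  | 0 => Eq
  | m + 1 => R ⨟ altComp S R m

/-- The `h`-th relational power `R ⨟ R ⨟ ⋯ ⨟ R`. -/
def relPow (R : A → A → Prop) (h : ℕ) : A → A → Prop := altComp R R h

/-- `nest α β γ ℓ` is the nested expression
`α ⊓ (β ⨟ (α ⊓ (γ ⨟ (α ⊓ (β ⨟ ⋯ ⨟ β)) ⨟ γ)) ⨟ β)` with `ℓ` pairs of brackets: for instance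
`nest α β γ 1 = α ⊓ (β ⨟ (α ⊓ γ) ⨟ β)` and
`nest α β γ 2 = α ⊓ (β ⨟ (α ⊓ (γ ⨟ (α ⊓ β) ⨟ γ)) ⨟ β)`. -/
def nest (α β γ : A → A → Prop) : ℕ → A → A → Prop
  | 0 => α ⊓ β
  | l + 1 => α ⊓ (β ⨟ nest α γ β l ⨟ β)

end Relations

section Algebras

variable (L : FirstOrder.Language.{u, 0}) {A : Type u} [L.Structure A]

/-- Reflexive and admissible (compatible with all operations) relations. -/
structure IsAdmissible (R : A → A → Prop) : Prop where
  refl : ∀ a, R a a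
  compat : ∀ (n : ℕ) (f : L.Functions n) (a b : Fin n → A),
    (∀ i, R (a i) (b i)) →
      R (FirstOrder.Language.Structure.funMap f a) (FirstOrder.Language.Structure.funMap f b)

/-- Tolerances: reflexive, symmetric, admissible relations. -/
structure IsTolerance (R : A → A → Prop) : Prop extends IsAdmissible L R where
  symm : ∀ a b, R a b → R b a

/-- Congruences: admissible equivalence relations. -/
structure IsCongruence (R : A → A → Prop) : Prop extends IsTolerance L R where
  trans : ∀ a b c, R a b → R b c → R a c

variable (A) in
/-- The congruences of the algebra `A`, ordered by inclusion. -/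
abbrev Congruence : Type u := {R : A → A → Prop // IsCongruence L R}

instance : InfSet (Congruence L A) where
  sInf S := ⟨fun a b => ∀ R ∈ S, R.1 a b,
    { refl := fun a R _ => R.2.refl a
      compat := fun n f a b h R hR => R.2.compat n f a b (fun i => h i R hR)
      symm := fun a b h R hR => R.2.symm a b (h R hR)
      trans := fun a b c h h' R hR => R.2.trans a b c (h R hR) (h' R hR) }⟩

instance : CompleteLattice (Congruence L A) :=
  completeLatticeOfInf _ fun _ =>
    ⟨fun R hR _ _ h => h R hR, fun _ hT _ _ h _ hR => hT hR _ _ h⟩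

end Algebras

/-- A variety, presented by a signature of finitary operation symbols and a set of equations. -/
structure Variety where
  /-- The signature. -/
  L : FirstOrder.Language.{u, 0}
  /-- There are no relation symbols. -/
  algebraic : L.IsAlgebraic
  /-- The equations, in countably many variables. -/
  eqs : Set (L.Term ℕ × L.Term ℕ)

/-- The algebra `A` belongs to the variety `V`. -/
def Variety.Mem (V : Variety.{u}) (A : Type u) [V.L.Structure A] : Prop :=
  Nonempty A ∧ ∀ e ∈ V.eqs, ∀ v : ℕ → A, e.1.realize v = e.2.realize v

/-- Every algebra in `V` has a modular lattice of congruences. -/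
def Variety.CongruenceModular (V : Variety.{u}) : Prop :=
  ∀ (A : Type u) [V.L.Structure A], V.Mem A → IsModularLattice (Congruence V.L A)

/-- Names for the thirteen spectra
`D, D⌣, D*, T, T⌣, T*, T**, Tʳ, Tʳ⌣, R, Dʳ, Dʳ⌣, C`. -/
inductive Spec : Type
  | D | Drev | Dstar | T | Trev | Tstar | Tstarstar | Trel | Trelrev | R | Drel | Drelrev | C

/-- The arguments of each of the spectra. -/
def Spec.Arg : Spec → Type
  | .D | .Drev | .Trev | .Tstar | .Tstarstar | .Trelrev | .Drel | .Drelrev => {m : ℕ // 3 ≤ m}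
  | .T | .Trel | .R => {m : ℕ // 2 ≤ m}
  | .Dstar => {l : ℕ // 1 ≤ l}
  | .C => {p : ℕ × ℕ // 1 ≤ p.1 ∧ 1 ≤ p.2}

section Identities

variable (L : FirstOrder.Language.{u, 0}) (A : Type u) [L.Structure A]

/-- An inclusion between relations built from three congruences of `A` holds universally. -/
def ForallCongr (lhs rhs : (α β γ : A → A → Prop) → A → A → Prop) : Prop :=
  ∀ α β γ : A → A → Prop, IsCongruence L α → IsCongruence L β → IsCongruence L γ →
    lhs α β γ ≤ rhs α β γ

/-- An inclusion between relations built from a congruence and two reflexive admissible relations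
of `A` holds universally. -/
def ForallAdm (lhs rhs : (α R S : A → A → Prop) → A → A → Prop) : Prop :=
  ∀ α R S : A → A → Prop, IsCongruence L α → IsAdmissible L R → IsAdmissible L S →
    lhs α R S ≤ rhs α R S

/-- An inclusion between relations built from two tolerances of `A` holds universally. -/
def ForallTol (lhs rhs : (Θ Ψ : A → A → Prop) → A → A → Prop) : Prop :=
  ∀ Θ Ψ : A → A → Prop, IsTolerance L Θ → IsTolerance L Ψ → lhs Θ Ψ ≤ rhs Θ Ψ

/-- `s.HoldsIn L A x k`: the inclusion that defines the spectrum `s`, with argument `x` and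
with `k` as the bound on the right-hand side, holds in the algebra `A`. -/
def Spec.HoldsIn : (s : Spec) → s.Arg → ℕ → Prop
  | .D, ⟨m, _⟩, k => ForallCongr L A
      (fun α β γ => α ⊓ altComp β (α ⊓ γ) m)
      (fun α β γ => altComp (α ⊓ β) (α ⊓ γ) k)
  | .Drev, ⟨m, _⟩, k => ForallCongr L A
      (fun α β γ => α ⊓ altComp β (α ⊓ γ) m)
      (fun α β γ => altComp (α ⊓ γ) (α ⊓ β) k)
  | .Dstar, ⟨l, _⟩, k => ForallCongr L A
      (fun α β γ => nest α β γ l)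
      (fun α β γ => altComp (α ⊓ β) (α ⊓ γ) k)
  | .T, ⟨m, _⟩, k => ForallCongr L A
      (fun α β γ => α ⊓ altComp β γ m)
      (fun α β γ => (α ⊓ (γ ⨟ β)) ⨟ altComp (α ⊓ γ) (α ⊓ β) k)
  | .Trev, ⟨m, _⟩, k => ForallCongr L A
      (fun α β γ => α ⊓ altComp β γ m)
      (fun α β γ => (α ⊓ (β ⨟ γ)) ⨟ altComp (α ⊓ β) (α ⊓ γ) k)
  | .Tstar, ⟨m, _⟩, k => ForallCongr L A
      (fun α β γ => α ⊓ altComp β γ m)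
      (fun α β γ => (α ⊓ (γ ⨟ β ⨟ γ)) ⨟ altComp (α ⊓ β) (α ⊓ γ) k)
  | .Tstarstar, ⟨m, _⟩, k => ForallCongr L A
      (fun α β γ => α ⊓ altComp β γ m)
      (fun α β γ => relPow (α ⊓ (γ ⨟ β ⨟ γ)) k)
  | .Trel, ⟨m, _⟩, k => ForallAdm L A
      (fun α R S => α ⊓ altComp R S m)
      (fun α R S => (α ⊓ (S ⨟ R)) ⨟ altComp (α ⊓ S) (α ⊓ R) k)
  | .Trelrev, ⟨m, _⟩, k => ForallAdm L A
      (fun α R S => α ⊓ altComp R S m)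
      (fun α R S => (α ⊓ (R ⨟ S)) ⨟ altComp (α ⊓ R) (α ⊓ S) k)
  | .R, ⟨m, _⟩, k => ForallAdm L A
      (fun α R _ => α ⊓ relPow R m)
      (fun α R _ => relPow (α ⊓ R) k)
  | .Drel, ⟨m, _⟩, k => ForallAdm L A
      (fun α R S => α ⊓ altComp R (α ⊓ S) m)
      (fun α R S => altComp (α ⊓ R) (α ⊓ S) k)
  | .Drelrev, ⟨m, _⟩, k => ForallAdm L A
      (fun α R S => α ⊓ altComp R (α ⊓ S) m)
      (fun α R S => altComp (α ⊓ S) (α ⊓ R) k)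
  | .C, ⟨(h, j), _⟩, k => ForallTol L A
      (fun Θ Ψ => relPow Θ h ⊓ relPow Ψ j)
      (fun Θ Ψ => relPow (Θ ⊓ Ψ) k)

end Identities

/-- The bounds `k` for which all algebras of `V` satisfy the inclusion that defines `s` at `x`. -/
def Variety.bounds (V : Variety.{u}) (s : Spec) (x : s.Arg) : Set ℕ :=
  {k | ∀ (A : Type u) [V.L.Structure A], V.Mem A → s.HoldsIn V.L A x k}

/-- The value at `x` of the spectrum `s` of `V`: the least bound, and `⊤` if there is none. -/
noncomputable def Variety.spectrum (V : Variety.{u}) (s : Spec) (x : s.Arg) : ℕ∞ :=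
  ⨅ k ∈ V.bounds s x, (k : ℕ∞)

/-- The functions realized as the spectrum `s` of some congruence modular variety. -/
def realizable (s : Spec) : Set (s.Arg → ℕ) :=
  {f | ∃ V : Variety.{u}, V.CongruenceModular ∧ ∀ x, V.spectrum s x = (f x : ℕ∞)}

/-- The 13-tuples of functions realized as the spectra of some congruence modular variety. -/
def realizableTuples : Set ((s : Spec) → s.Arg → ℕ) :=
  {f | ∃ V : Variety.{u}, V.CongruenceModular ∧ ∀ s x, V.spectrum s x = (f s x : ℕ∞)}

end UnivAlg

/-!
The variety `W` is the non-indexed product of `V` and `V'`. Its signature has a binary symbol `dec`,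
read on a product `A × B` as `dec (a, b) (a', b') = (a, b')`, and one symbol for each operation of
`V` and of `V'`. An `n`-ary operation `f` of `V` becomes `(n + 1)`-ary: it acts as `f` on the first
coordinates of its last `n` arguments and copies the second coordinate of its first argument (this
extra argument is what makes constants harmless), and symmetrically for `V'`. The equations of `W`
are all those valid in every such product `A × B` with `A ∈ V` and `B ∈ V'`.

Conversely every algebra of `W` is such a product: with a base point `p`, the factors are the images
of `x ↦ dec x p` and `x ↦ dec p x` (`Variety.prod_exists_decomposition`). Because of `dec`, every
reflexive admissible relation on a product is the product of relations on the factors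
(`IsDecomposition.pull_leftRel_rightRel`), and since intersection and composition of relations
are computed factorwise, an inclusion holds in the product iff it holds in both factors
(`IsDecomposition.holdsIn_iff`). So the bounds for `W` are the common bounds for `V` and `V'`; as
sets of bounds are upward closed, their least elements satisfy the maximum rule. Finally, the
congruence lattice of the product is the product of the congruence lattices, hence modular.
-/

open FirstOrder Language Structure

namespace UnivAlg

/-! ### Reflexivity and monotonicity of relational operations -/

section Reflexive

variable {A : Type u} {R S : A → A → Prop}

instance refl_inf [Std.Refl R] [Std.Refl S] : Std.Refl (R ⊓ S) :=
  ⟨fun a => ⟨Std.Refl.refl a, Std.Refl.refl a⟩⟩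

instance refl_comp [Std.Refl R] [Std.Refl S] : Std.Refl (R ⨟ S) :=
  ⟨fun a => ⟨a, Std.Refl.refl a, Std.Refl.refl a⟩⟩

theorem altComp_refl (m : ℕ) :
    ∀ (R S : A → A → Prop) [Std.Refl R] [Std.Refl S], Std.Refl (altComp R S m) := by
  induction m with
  | zero => intro R S _ _; exact ⟨fun _ => rfl⟩
  | succ m ih => intro R S _ _; have := ih S R; exact refl_comp

instance refl_altComp [Std.Refl R] [Std.Refl S] (m : ℕ) : Std.Refl (altComp R S m) :=
  altComp_refl m R S

instance refl_relPow [Std.Refl R] (m : ℕ) : Std.Refl (relPow R m) := altComp_refl m R R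

theorem nest_refl (l : ℕ) :
    ∀ (α β γ : A → A → Prop) [Std.Refl α] [Std.Refl β] [Std.Refl γ], Std.Refl (nest α β γ l) := by
  induction l with
  | zero => intro α β γ _ _ _; exact refl_inf
  | succ l ih => intro α β γ _ _ _; have := ih α γ β; exact refl_inf

instance refl_nest {α β γ : A → A → Prop} [Std.Refl α] [Std.Refl β] [Std.Refl γ] (l : ℕ) :
    Std.Refl (nest α β γ l) :=
  nest_refl l α β γ

theorem comp_le_comp_right {S' : A → A → Prop} (h : S ≤ S') : R ⨟ S ≤ R ⨟ S' :=
  fun _ _ ⟨b, hb, hb'⟩ => ⟨b, hb, h _ _ hb'⟩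

theorem altComp_le_altComp_succ (m : ℕ) :
    ∀ (R S : A → A → Prop) [Std.Refl R] [Std.Refl S], altComp R S m ≤ altComp R S (m + 1) := by
  induction m with
  | zero => rintro R S _ _ a _ rfl; exact ⟨a, Std.Refl.refl a, rfl⟩
  | succ m ih => intro R S _ _; exact comp_le_comp_right (ih S R)

theorem IsAdmissible.std_refl {L : FirstOrder.Language.{u, 0}} [L.Structure A]
    (h : IsAdmissible L R) : Std.Refl R := ⟨h.refl⟩

variable (A) in
theorem isCongruence_eq (L : FirstOrder.Language.{u, 0}) [L.Structure A] :
    IsCongruence L (fun a b : A => a = b) where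
  refl _ := rfl
  compat _ f a b h := by rw [show a = b from funext h]
  symm _ _ := Eq.symm
  trans _ _ _ := Eq.trans

end Reflexive

section Mono

variable {L : FirstOrder.Language.{u, 0}} {A : Type u} [L.Structure A]

theorem ForallCongr.mono {l r r' : (α β γ : A → A → Prop) → A → A → Prop}
    (hr : ∀ α β γ [Std.Refl α] [Std.Refl β] [Std.Refl γ], r α β γ ≤ r' α β γ)
    (h : ForallCongr L A l r) : ForallCongr L A l r' := by
  intro α β γ hα hβ hγ
  have := hα.std_refl; have := hβ.std_refl; have := hγ.std_refl
  exact (h α β γ hα hβ hγ).trans (hr α β γ)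

theorem ForallAdm.mono {l r r' : (α R S : A → A → Prop) → A → A → Prop}
    (hr : ∀ α β γ [Std.Refl α] [Std.Refl β] [Std.Refl γ], r α β γ ≤ r' α β γ)
    (h : ForallAdm L A l r) : ForallAdm L A l r' := by
  intro α β γ hα hβ hγ
  have := hα.std_refl; have := hβ.std_refl; have := hγ.std_refl
  exact (h α β γ hα hβ hγ).trans (hr α β γ)

theorem ForallTol.mono {l r r' : (Θ Ψ : A → A → Prop) → A → A → Prop}
    (hr : ∀ α β [Std.Refl α] [Std.Refl β], r α β ≤ r' α β)
    (h : ForallTol L A l r) : ForallTol L A l r' := by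
  intro α β hα hβ
  have := hα.std_refl; have := hβ.std_refl
  exact (h α β hα hβ).trans (hr α β)

/-- The right-hand sides of the inclusions increase with `k`, as all relations involved are
reflexive. -/
theorem Spec.HoldsIn.succ {s : Spec} {x : s.Arg} {k : ℕ} (h : s.HoldsIn L A x k) :
    s.HoldsIn L A x (k + 1) := by
  cases s
  case D | Drev | Dstar | Tstarstar =>
    exact ForallCongr.mono (fun _ _ _ => altComp_le_altComp_succ k _ _) h
  case T | Trev | Tstar =>
    exact ForallCongr.mono (fun _ _ _ => comp_le_comp_right (altComp_le_altComp_succ k _ _)) h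
  case Trel | Trelrev =>
    exact ForallAdm.mono (fun _ _ _ => comp_le_comp_right (altComp_le_altComp_succ k _ _)) h
  case R | Drel | Drelrev =>
    exact ForallAdm.mono (fun _ _ _ => altComp_le_altComp_succ k _ _) h
  case C => exact ForallTol.mono (fun _ _ => altComp_le_altComp_succ k _ _) h

end Mono

/-! ### Products of relations -/

section Pull

variable {M A B : Type u} (e : M ≃ A × B)

/-- The product of a relation on `A` and a relation on `B`, transported to `M` along a bijection
`M ≃ A × B`. -/
def pull (R : A → A → Prop) (S : B → B → Prop) : M → M → Prop :=
  fun x y => R (e x).1 (e y).1 ∧ S (e x).2 (e y).2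

variable (R R' R'' : A → A → Prop) (S S' S'' : B → B → Prop)

theorem pull_inf : pull e (R ⊓ R') (S ⊓ S') = pull e R S ⊓ pull e R' S' := by
  ext x y
  exact and_and_and_comm

theorem pull_comp : pull e (R ⨟ R') (S ⨟ S') = pull e R S ⨟ pull e R' S' := by
  ext x y
  constructor
  · rintro ⟨⟨a, ha, ha'⟩, ⟨b, hb, hb'⟩⟩
    exact ⟨e.symm (a, b), by simp [pull, *], by simp [pull, *]⟩
  · rintro ⟨z, ⟨h, h'⟩, ⟨k, k'⟩⟩
    exact ⟨⟨_, h, k⟩, ⟨_, h', k'⟩⟩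

theorem pull_eq : pull e Eq Eq = Eq := by
  ext x y
  simp [pull, ← Prod.ext_iff]

theorem pull_altComp (m : ℕ) :
    pull e (altComp R R' m) (altComp S S' m) = altComp (pull e R S) (pull e R' S') m := by
  induction m generalizing R R' S S' with
  | zero => exact pull_eq e
  | succ m ih => simp only [altComp, pull_comp, ih]

theorem pull_relPow (m : ℕ) : pull e (relPow R m) (relPow S m) = relPow (pull e R S) m :=
  pull_altComp e R R S S m

theorem pull_nest (l : ℕ) :
    pull e (nest R R' R'' l) (nest S S' S'' l) =
      nest (pull e R S) (pull e R' S') (pull e R'' S'') l := by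
  induction l generalizing R' R'' S' S'' with
  | zero => exact pull_inf e ..
  | succ l ih => simp only [nest, pull_comp, pull_inf, ih]

variable {R R' S S'}

theorem pull_mono (h : R ≤ R') (h' : S ≤ S') : pull e R S ≤ pull e R' S' :=
  fun _ _ hxy => ⟨h _ _ hxy.1, h' _ _ hxy.2⟩

theorem le_left_of_pull_le [Nonempty B] [Std.Refl S] (h : pull e R S ≤ pull e R' S') :
    R ≤ R' := by
  intro a a' ha
  have b := Classical.arbitrary B
  simpa using (h (e.symm (a, b)) (e.symm (a', b))
    (by simpa [pull] using ⟨ha, Std.Refl.refl b⟩)).1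

theorem le_right_of_pull_le [Nonempty A] [Std.Refl R] (h : pull e R S ≤ pull e R' S') :
    S ≤ S' := by
  intro b b' hb
  have a := Classical.arbitrary A
  simpa using (h (e.symm (a, b)) (e.symm (a, b'))
    (by simpa [pull] using ⟨Std.Refl.refl a, hb⟩)).2

end Pull

/-! ### Non-indexed products of algebras -/

section ProdLanguage

variable (L L' : FirstOrder.Language.{u, 0})

/-- The operation symbols of the non-indexed product of the signatures `L` and `L'`. -/
inductive ProdFun : ℕ → Type u
  /-- The decomposition operation, sending `(a, b)` and `(a', b')` to `(a, b')`. -/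
  | dec : ProdFun 2
  /-- The action of `f` on the first coordinates of all arguments but the first one. The second
  coordinate of the result is that of the first argument. -/
  | left {n : ℕ} (f : L.Functions n) : ProdFun (n + 1)
  /-- The action of `f` on the second coordinates of all arguments but the first one. The first
  coordinate of the result is that of the first argument. -/
  | right {n : ℕ} (f : L'.Functions n) : ProdFun (n + 1)

/-- The signature of the non-indexed product. -/
abbrev prodLanguage : FirstOrder.Language.{u, 0} := ⟨ProdFun L L', fun _ => Empty⟩

/-- The bijection `e` exhibits `M` as the non-indexed product of the algebras `A` and `B`. -/
structure IsDecomposition {M A B : Type u} [(prodLanguage L L').Structure M] [L.Structure A]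
    [L'.Structure B] (e : M ≃ A × B) : Prop where
  map_dec (x : Fin 2 → M) :
    e (funMap (L := prodLanguage L L') ProdFun.dec x) = ((e (x 0)).1, (e (x 1)).2)
  map_left {n : ℕ} (f : L.Functions n) (x : Fin (n + 1) → M) :
    e (funMap (L := prodLanguage L L') (ProdFun.left f) x) =
      (funMap f fun i => (e (x i.succ)).1, (e (x 0)).2)
  map_right {n : ℕ} (f : L'.Functions n) (x : Fin (n + 1) → M) :
    e (funMap (L := prodLanguage L L') (ProdFun.right f) x) =
      ((e (x 0)).1, funMap f fun i => (e (x i.succ)).2)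

/-- The operations of the non-indexed product of `A` and `B`. -/
def prodFunMap (A B : Type u) [L.Structure A] [L'.Structure B] :
    ∀ {n : ℕ}, ProdFun L L' n → (Fin n → A × B) → A × B
  | _, .dec, x => ((x 0).1, (x 1).2)
  | _, .left f, x => (funMap f fun i => (x i.succ).1, (x 0).2)
  | _, .right f, x => ((x 0).1, funMap f fun i => (x i.succ).2)

/-- The non-indexed product of the algebras `A` and `B`. -/
instance prodStructure (A B : Type u) [L.Structure A] [L'.Structure B] :
    (prodLanguage L L').Structure (A × B) where
  funMap f x := prodFunMap L L' A B f x
  RelMap r _ := r.elim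

theorem isDecomposition_refl (A B : Type u) [L.Structure A] [L'.Structure B] :
    IsDecomposition L L' (Equiv.refl (A × B)) :=
  ⟨fun _ => rfl, fun _ _ => rfl, fun _ _ => rfl⟩

end ProdLanguage

namespace IsDecomposition

variable {L L' : FirstOrder.Language.{u, 0}} {M A B : Type u} [(prodLanguage L L').Structure M]
  [L.Structure A] [L'.Structure B] {e : M ≃ A × B}

/-! ### Admissible relations of a product are products -/

variable (e) in
/-- The trace of a relation on the first factor, with the second coordinate frozen to that of
the base point `o`. -/
def leftRel (o : M) (R : M → M → Prop) : A → A → Prop :=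
  fun a a' => R (e.symm (a, (e o).2)) (e.symm (a', (e o).2))

variable (e) in
/-- The trace of a relation on the second factor, with the first coordinate frozen to that of
the base point `o`. -/
def rightRel (o : M) (R : M → M → Prop) : B → B → Prop :=
  fun b b' => R (e.symm ((e o).1, b)) (e.symm ((e o).1, b'))

/-- Admissible relations are compatible with the decomposition operation, which recombines the
first coordinate of `x` with the second coordinate of `y`. -/
theorem rel_dec (hd : IsDecomposition L L' e) {R : M → M → Prop}
    (hR : IsAdmissible (prodLanguage L L') R) {x x' y y' : M} (h : R x x') (h' : R y y') :
    R (e.symm ((e x).1, (e y).2)) (e.symm ((e x').1, (e y').2)) := by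
  have key (x y : M) : e.symm ((e x).1, (e y).2) =
      funMap (L := prodLanguage L L') ProdFun.dec ![x, y] := by
    rw [Equiv.symm_apply_eq, hd.map_dec]; rfl
  rw [key, key]
  exact hR.compat 2 _ _ _ (by simpa [Fin.forall_fin_two] using ⟨h, h'⟩)

theorem pull_leftRel_rightRel (hd : IsDecomposition L L' e) (o : M) {R : M → M → Prop}
    (hR : IsAdmissible (prodLanguage L L') R) :
    pull e (leftRel e o R) (rightRel e o R) = R := by
  ext x y
  constructor
  · rintro ⟨h, h'⟩
    simpa using hd.rel_dec hR h h'
  · intro h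
    exact ⟨hd.rel_dec hR h (hR.refl o), hd.rel_dec hR (hR.refl o) h⟩

theorem leftRel_isAdmissible (hd : IsDecomposition L L' e) (o : M) {R : M → M → Prop}
    (hR : IsAdmissible (prodLanguage L L') R) : IsAdmissible L (leftRel e o R) where
  refl _ := hR.refl _
  compat n f a b h := by
    have key (a : Fin n → A) : e.symm (funMap f a, (e o).2) =
        funMap (L := prodLanguage L L') (ProdFun.left f)
          (Fin.cons o fun i => e.symm (a i, (e o).2)) := by
      rw [Equiv.symm_apply_eq, hd.map_left]; simp
    unfold leftRel
    rw [key, key]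
    exact hR.compat _ _ _ _ (Fin.cases (hR.refl o) h)

theorem rightRel_isAdmissible (hd : IsDecomposition L L' e) (o : M) {R : M → M → Prop}
    (hR : IsAdmissible (prodLanguage L L') R) : IsAdmissible L' (rightRel e o R) where
  refl _ := hR.refl _
  compat n f a b h := by
    have key (a : Fin n → B) : e.symm ((e o).1, funMap f a) =
        funMap (L := prodLanguage L L') (ProdFun.right f)
          (Fin.cons o fun i => e.symm ((e o).1, a i)) := by
      rw [Equiv.symm_apply_eq, hd.map_right]; simp
    unfold rightRel
    rw [key, key]
    exact hR.compat _ _ _ _ (Fin.cases (hR.refl o) h)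

theorem leftRel_isTolerance (hd : IsDecomposition L L' e) (o : M) {R : M → M → Prop}
    (hR : IsTolerance (prodLanguage L L') R) : IsTolerance L (leftRel e o R) where
  toIsAdmissible := hd.leftRel_isAdmissible o hR.toIsAdmissible
  symm _ _ := hR.symm _ _

theorem rightRel_isTolerance (hd : IsDecomposition L L' e) (o : M) {R : M → M → Prop}
    (hR : IsTolerance (prodLanguage L L') R) : IsTolerance L' (rightRel e o R) where
  toIsAdmissible := hd.rightRel_isAdmissible o hR.toIsAdmissible
  symm _ _ := hR.symm _ _

theorem leftRel_isCongruence (hd : IsDecomposition L L' e) (o : M) {R : M → M → Prop}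
    (hR : IsCongruence (prodLanguage L L') R) : IsCongruence L (leftRel e o R) where
  toIsTolerance := hd.leftRel_isTolerance o hR.toIsTolerance
  trans _ _ _ := hR.trans _ _ _

theorem rightRel_isCongruence (hd : IsDecomposition L L' e) (o : M) {R : M → M → Prop}
    (hR : IsCongruence (prodLanguage L L') R) : IsCongruence L' (rightRel e o R) where
  toIsTolerance := hd.rightRel_isTolerance o hR.toIsTolerance
  trans _ _ _ := hR.trans _ _ _

theorem pull_isAdmissible (hd : IsDecomposition L L' e) {R : A → A → Prop} {S : B → B → Prop}
    (hR : IsAdmissible L R) (hS : IsAdmissible L' S) :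
    IsAdmissible (prodLanguage L L') (pull e R S) where
  refl _ := ⟨hR.refl _, hS.refl _⟩
  compat n f a b h := by
    unfold pull
    cases f with
    | dec => rw [hd.map_dec, hd.map_dec]; exact ⟨(h 0).1, (h 1).2⟩
    | left f =>
      rw [hd.map_left, hd.map_left]; exact ⟨hR.compat _ _ _ _ fun i => (h i.succ).1, (h 0).2⟩
    | right f =>
      rw [hd.map_right, hd.map_right]; exact ⟨(h 0).1, hS.compat _ _ _ _ fun i => (h i.succ).2⟩

theorem pull_isTolerance (hd : IsDecomposition L L' e) {R : A → A → Prop} {S : B → B → Prop}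
    (hR : IsTolerance L R) (hS : IsTolerance L' S) :
    IsTolerance (prodLanguage L L') (pull e R S) where
  toIsAdmissible := hd.pull_isAdmissible hR.toIsAdmissible hS.toIsAdmissible
  symm _ _ h := ⟨hR.symm _ _ h.1, hS.symm _ _ h.2⟩

theorem pull_isCongruence (hd : IsDecomposition L L' e) {R : A → A → Prop} {S : B → B → Prop}
    (hR : IsCongruence L R) (hS : IsCongruence L' S) :
    IsCongruence (prodLanguage L L') (pull e R S) where
  toIsTolerance := hd.pull_isTolerance hR.toIsTolerance hS.toIsTolerance
  trans _ _ _ h h' := ⟨hR.trans _ _ _ h.1 h'.1, hS.trans _ _ _ h.2 h'.2⟩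

/-- The congruence lattice of a non-indexed product is the product of the congruence lattices. -/
def congruenceOrderIso (hd : IsDecomposition L L' e) (o : M) :
    Congruence (prodLanguage L L') M ≃o Congruence L A × Congruence L' B where
  toFun R := (⟨_, hd.leftRel_isCongruence o R.2⟩, ⟨_, hd.rightRel_isCongruence o R.2⟩)
  invFun R := ⟨_, hd.pull_isCongruence R.1.2 R.2.2⟩
  left_inv R := Subtype.ext (hd.pull_leftRel_rightRel o R.2.toIsAdmissible)
  right_inv R := by
    refine Prod.ext (Subtype.ext ?_) (Subtype.ext ?_)
    · ext a a'; simp [leftRel, pull, R.2.2.refl]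
    · ext b b'; simp [rightRel, pull, R.1.2.refl]
  map_rel_iff' {R S} := by
    constructor
    · rintro ⟨h, h'⟩
      have key : pull e (leftRel e o R.1) (rightRel e o R.1) ≤
          pull e (leftRel e o S.1) (rightRel e o S.1) := pull_mono e h h'
      rwa [hd.pull_leftRel_rightRel o R.2.toIsAdmissible,
        hd.pull_leftRel_rightRel o S.2.toIsAdmissible] at key
    · intro h
      exact ⟨fun _ _ => h _ _, fun _ _ => h _ _⟩

theorem isModularLattice (hd : IsDecomposition L L' e) [Nonempty M]
    [IsModularLattice (Congruence L A)] [IsModularLattice (Congruence L' B)] :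
    IsModularLattice (Congruence (prodLanguage L L') M) where
  sup_inf_le_assoc_of_le {x} y {z} hxz := by
    let φ := hd.congruenceOrderIso (Classical.arbitrary M)
    have h := φ.monotone hxz
    rw [← φ.le_iff_le]
    simp only [map_sup, map_inf]
    exact ⟨IsModularLattice.sup_inf_le_assoc_of_le _ h.1,
      IsModularLattice.sup_inf_le_assoc_of_le _ h.2⟩

/-! ### Inclusions hold in a product iff they hold in the factors -/

/-- Here `l` and `r` are the two sides of an inclusion, computed in `M`, `A` and `B`. To refer an
inclusion from `M` to one factor, the variables are interpreted by equality on the other factor;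
reflexivity of the left-hand side there makes the condition on that factor harmless. -/
theorem forallCongr_iff (hd : IsDecomposition L L' e) [Nonempty A] [Nonempty B]
    {lM rM : (α β γ : M → M → Prop) → M → M → Prop}
    {lA rA : (α β γ : A → A → Prop) → A → A → Prop}
    {lB rB : (α β γ : B → B → Prop) → B → B → Prop}
    (hl : ∀ α β γ α' β' γ', lM (pull e α α') (pull e β β') (pull e γ γ') =
      pull e (lA α β γ) (lB α' β' γ'))
    (hr : ∀ α β γ α' β' γ', rM (pull e α α') (pull e β β') (pull e γ γ') =
      pull e (rA α β γ) (rB α' β' γ'))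
    (hA : ∀ α β γ [Std.Refl α] [Std.Refl β] [Std.Refl γ], Std.Refl (lA α β γ))
    (hB : ∀ α β γ [Std.Refl α] [Std.Refl β] [Std.Refl γ], Std.Refl (lB α β γ)) :
    ForallCongr (prodLanguage L L') M lM rM ↔ ForallCongr L A lA rA ∧ ForallCongr L' B lB rB := by
  constructor
  · intro h
    have := (isCongruence_eq A L).std_refl
    have := (isCongruence_eq B L').std_refl
    constructor
    · intro α β γ hα hβ hγ
      have hE := isCongruence_eq B L'
      have key := h _ _ _ (hd.pull_isCongruence hα hE) (hd.pull_isCongruence hβ hE)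
        (hd.pull_isCongruence hγ hE)
      rw [hl, hr] at key
      have := hB (fun a b : B => a = b) (fun a b : B => a = b) (fun a b : B => a = b)
      exact le_left_of_pull_le e key
    · intro α β γ hα hβ hγ
      have hE := isCongruence_eq A L
      have key := h _ _ _ (hd.pull_isCongruence hE hα) (hd.pull_isCongruence hE hβ)
        (hd.pull_isCongruence hE hγ)
      rw [hl, hr] at key
      have := hA (fun a b : A => a = b) (fun a b : A => a = b) (fun a b : A => a = b)
      exact le_right_of_pull_le e key
  · rintro ⟨h, h'⟩ α β γ hα hβ hγ
    have o := e.symm (Classical.arbitrary (A × B))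
    have key := pull_mono e
      (h _ _ _ (hd.leftRel_isCongruence o hα) (hd.leftRel_isCongruence o hβ)
        (hd.leftRel_isCongruence o hγ))
      (h' _ _ _ (hd.rightRel_isCongruence o hα) (hd.rightRel_isCongruence o hβ)
        (hd.rightRel_isCongruence o hγ))
    rwa [← hl, ← hr, hd.pull_leftRel_rightRel o hα.toIsAdmissible,
      hd.pull_leftRel_rightRel o hβ.toIsAdmissible,
      hd.pull_leftRel_rightRel o hγ.toIsAdmissible] at key

/-- The analogue of `forallCongr_iff` for one congruence and two admissible relations. -/
theorem forallAdm_iff (hd : IsDecomposition L L' e) [Nonempty A] [Nonempty B]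
    {lM rM : (α R S : M → M → Prop) → M → M → Prop}
    {lA rA : (α R S : A → A → Prop) → A → A → Prop}
    {lB rB : (α R S : B → B → Prop) → B → B → Prop}
    (hl : ∀ α β γ α' β' γ', lM (pull e α α') (pull e β β') (pull e γ γ') =
      pull e (lA α β γ) (lB α' β' γ'))
    (hr : ∀ α β γ α' β' γ', rM (pull e α α') (pull e β β') (pull e γ γ') =
      pull e (rA α β γ) (rB α' β' γ'))
    (hA : ∀ α β γ [Std.Refl α] [Std.Refl β] [Std.Refl γ], Std.Refl (lA α β γ))
    (hB : ∀ α β γ [Std.Refl α] [Std.Refl β] [Std.Refl γ], Std.Refl (lB α β γ)) :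
    ForallAdm (prodLanguage L L') M lM rM ↔ ForallAdm L A lA rA ∧ ForallAdm L' B lB rB := by
  constructor
  · intro h
    have := (isCongruence_eq A L).std_refl
    have := (isCongruence_eq B L').std_refl
    constructor
    · intro α β γ hα hβ hγ
      have hE := isCongruence_eq B L'
      have key := h _ _ _ (hd.pull_isCongruence hα hE)
        (hd.pull_isAdmissible hβ hE.toIsAdmissible) (hd.pull_isAdmissible hγ hE.toIsAdmissible)
      rw [hl, hr] at key
      have := hB (fun a b : B => a = b) (fun a b : B => a = b) (fun a b : B => a = b)
      exact le_left_of_pull_le e key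
    · intro α β γ hα hβ hγ
      have hE := isCongruence_eq A L
      have key := h _ _ _ (hd.pull_isCongruence hE hα)
        (hd.pull_isAdmissible hE.toIsAdmissible hβ) (hd.pull_isAdmissible hE.toIsAdmissible hγ)
      rw [hl, hr] at key
      have := hA (fun a b : A => a = b) (fun a b : A => a = b) (fun a b : A => a = b)
      exact le_right_of_pull_le e key
  · rintro ⟨h, h'⟩ α β γ hα hβ hγ
    have o := e.symm (Classical.arbitrary (A × B))
    have key := pull_mono e
      (h _ _ _ (hd.leftRel_isCongruence o hα) (hd.leftRel_isAdmissible o hβ)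
        (hd.leftRel_isAdmissible o hγ))
      (h' _ _ _ (hd.rightRel_isCongruence o hα) (hd.rightRel_isAdmissible o hβ)
        (hd.rightRel_isAdmissible o hγ))
    rwa [← hl, ← hr, hd.pull_leftRel_rightRel o hα.toIsAdmissible,
      hd.pull_leftRel_rightRel o hβ, hd.pull_leftRel_rightRel o hγ] at key

/-- The analogue of `forallCongr_iff` for two tolerances. -/
theorem forallTol_iff (hd : IsDecomposition L L' e) [Nonempty A] [Nonempty B]
    {lM rM : (Θ Ψ : M → M → Prop) → M → M → Prop}
    {lA rA : (Θ Ψ : A → A → Prop) → A → A → Prop}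
    {lB rB : (Θ Ψ : B → B → Prop) → B → B → Prop}
    (hl : ∀ α β α' β', lM (pull e α α') (pull e β β') = pull e (lA α β) (lB α' β'))
    (hr : ∀ α β α' β', rM (pull e α α') (pull e β β') = pull e (rA α β) (rB α' β'))
    (hA : ∀ α β [Std.Refl α] [Std.Refl β], Std.Refl (lA α β))
    (hB : ∀ α β [Std.Refl α] [Std.Refl β], Std.Refl (lB α β)) :
    ForallTol (prodLanguage L L') M lM rM ↔ ForallTol L A lA rA ∧ ForallTol L' B lB rB := by
  constructor
  · intro h
    have := (isCongruence_eq A L).std_refl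
    have := (isCongruence_eq B L').std_refl
    constructor
    · intro α β hα hβ
      have hE := (isCongruence_eq B L').toIsTolerance
      have key := h _ _ (hd.pull_isTolerance hα hE) (hd.pull_isTolerance hβ hE)
      rw [hl, hr] at key
      have := hB (fun a b : B => a = b) (fun a b : B => a = b)
      exact le_left_of_pull_le e key
    · intro α β hα hβ
      have hE := (isCongruence_eq A L).toIsTolerance
      have key := h _ _ (hd.pull_isTolerance hE hα) (hd.pull_isTolerance hE hβ)
      rw [hl, hr] at key
      have := hA (fun a b : A => a = b) (fun a b : A => a = b)
      exact le_right_of_pull_le e key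
  · rintro ⟨h, h'⟩ α β hα hβ
    have o := e.symm (Classical.arbitrary (A × B))
    have key := pull_mono e
      (h _ _ (hd.leftRel_isTolerance o hα) (hd.leftRel_isTolerance o hβ))
      (h' _ _ (hd.rightRel_isTolerance o hα) (hd.rightRel_isTolerance o hβ))
    rwa [← hl, ← hr, hd.pull_leftRel_rightRel o hα.toIsAdmissible,
      hd.pull_leftRel_rightRel o hβ.toIsAdmissible] at key

theorem holdsIn_iff (hd : IsDecomposition L L' e) [Nonempty A] [Nonempty B] (s : Spec)
    (x : s.Arg) (k : ℕ) :
    s.HoldsIn (prodLanguage L L') M x k ↔ s.HoldsIn L A x k ∧ s.HoldsIn L' B x k := by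
  cases s
  case D | Drev | Dstar | T | Trev | Tstar | Tstarstar =>
    refine hd.forallCongr_iff ?_ ?_ ?_ ?_ <;> intros
    iterate 2
      simp only [pull_inf, pull_comp, pull_altComp, pull_relPow, pull_nest]
    all_goals infer_instance
  case Trel | Trelrev | R | Drel | Drelrev =>
    refine hd.forallAdm_iff ?_ ?_ ?_ ?_ <;> intros
    iterate 2
      simp only [pull_inf, pull_comp, pull_altComp, pull_relPow]
    all_goals infer_instance
  case C =>
    refine hd.forallTol_iff ?_ ?_ ?_ ?_ <;> intros
    iterate 2
      simp only [pull_inf, pull_relPow]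
    all_goals infer_instance

end IsDecomposition

/-! ### The non-indexed product of two varieties -/

namespace Variety

variable (V V' : Variety.{u})

/-- The equation between the terms `s` and `t` holds in the non-indexed product of any algebra of
`V` and any algebra of `V'`. -/
def ProdValid {ι : Type} (s t : (prodLanguage V.L V'.L).Term ι) : Prop :=
  ∀ (A B : Type u) [V.L.Structure A] [V'.L.Structure B], V.Mem A → V'.Mem B →
    ∀ v : ι → A × B, s.realize v = t.realize v

/-- The non-indexed product of two varieties. Its equations are all those that hold in the
non-indexed products of the algebras of the two varieties. -/
abbrev prod : Variety.{u} where
  L := prodLanguage V.L V'.L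
  algebraic _ := inferInstanceAs (IsEmpty Empty)
  eqs := {e | V.ProdValid V' e.1 e.2}

theorem prod_mem {A B : Type u} [V.L.Structure A] [V'.L.Structure B] (hA : V.Mem A)
    (hB : V'.Mem B) :
    (V.prod V').Mem (A × B) :=
  have := hA.1
  have := hB.1
  ⟨inferInstance, fun _ he => he A B hA hB⟩

/-- The equations of the product variety are in variables from `ℕ`, but any countable type of
variables will do. -/
theorem ProdValid.realize_eq {V V' : Variety.{u}} {M : Type u}
    [(prodLanguage V.L V'.L).Structure M] (hM : (V.prod V').Mem M) {ι : Type} [Countable ι]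
    {s t : (prodLanguage V.L V'.L).Term ι} (h : V.ProdValid V' s t) (v : ι → M) :
    s.realize v = t.realize v := by
  obtain ⟨g, hg⟩ := exists_injective_nat ι
  have hmem : (s.relabel g, t.relabel g) ∈ (V.prod V').eqs := by
    intro A B _ _ hA hB w
    rw [Term.realize_relabel, Term.realize_relabel]
    exact h A B hA hB (w ∘ g)
  have o := hM.1.some
  have key := hM.2 _ hmem (Function.extend g v fun _ => o)
  rwa [Term.realize_relabel, Term.realize_relabel, Function.extend_comp hg] at key

section Translation

variable {L L' : FirstOrder.Language.{u, 0}}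

/-- The decomposition operation. -/
def dec (L L' : FirstOrder.Language.{u, 0}) {M : Type u} [(prodLanguage L L').Structure M]
    (x y : M) : M :=
  funMap (L := prodLanguage L L') ProdFun.dec ![x, y]

/-- The operation coming from the symbol `f` of the first signature, with its additional argument
`z` made explicit. -/
def leftOp (L' : FirstOrder.Language.{u, 0}) {M : Type u} [(prodLanguage L L').Structure M]
    {n : ℕ} (f : L.Functions n) (z : M) (x : Fin n → M) : M :=
  funMap (L := prodLanguage L L') (ProdFun.left f) (Fin.cons z x)

/-- The operation coming from the symbol `f` of the second signature, with its additional argument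
`z` made explicit. -/
def rightOp (L : FirstOrder.Language.{u, 0}) {M : Type u} [(prodLanguage L L').Structure M]
    {n : ℕ} (f : L'.Functions n) (z : M) (x : Fin n → M) : M :=
  funMap (L := prodLanguage L L') (ProdFun.right f) (Fin.cons z x)

section Product

variable {A B : Type u} [L.Structure A] [L'.Structure B]

theorem dec_prod (x y : A × B) : dec L L' x y = (x.1, y.2) := rfl

theorem leftOp_prod {n : ℕ} (f : L.Functions n) (z : A × B) (x : Fin n → A × B) :
    leftOp L' f z x = (funMap f fun i => (x i).1, z.2) := rfl

theorem rightOp_prod {n : ℕ} (f : L'.Functions n) (z : A × B) (x : Fin n → A × B) :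
    rightOp L f z x = (z.1, funMap f fun i => (x i).2) := rfl

end Product

/-- The term for the decomposition operation. -/
def decTerm {ι : Type} (s t : (prodLanguage L L').Term ι) : (prodLanguage L L').Term ι :=
  Functions.apply₂ (L := prodLanguage L L') ProdFun.dec s t

/-- The term for the operation `leftOp`. -/
def leftOpTerm {ι : Type} {n : ℕ} (f : L.Functions n) (s : (prodLanguage L L').Term ι)
    (ts : Fin n → (prodLanguage L L').Term ι) : (prodLanguage L L').Term ι :=
  .func (ProdFun.left f : (prodLanguage L L').Functions _) (Fin.cons s ts)

/-- The term for the operation `rightOp`. -/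
def rightOpTerm {ι : Type} {n : ℕ} (f : L'.Functions n) (s : (prodLanguage L L').Term ι)
    (ts : Fin n → (prodLanguage L L').Term ι) : (prodLanguage L L').Term ι :=
  .func (ProdFun.right f : (prodLanguage L L').Functions _) (Fin.cons s ts)

section Realize

variable {ι : Type} {M : Type u} [(prodLanguage L L').Structure M]

@[simp]
theorem realize_decTerm (s t : (prodLanguage L L').Term ι) (v : ι → M) :
    (decTerm s t).realize v = dec L L' (s.realize v) (t.realize v) :=
  Term.realize_functions_apply₂

@[simp]
theorem realize_leftOpTerm {n : ℕ} (f : L.Functions n) (s : (prodLanguage L L').Term ι)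
    (ts : Fin n → (prodLanguage L L').Term ι) (v : ι → M) :
    (leftOpTerm f s ts).realize v = leftOp L' f (s.realize v) fun i => (ts i).realize v := by
  rw [leftOpTerm, Term.realize_func, leftOp]
  congr 1
  exact funext (Fin.cases rfl fun _ => rfl)

@[simp]
theorem realize_rightOpTerm {n : ℕ} (f : L'.Functions n) (s : (prodLanguage L L').Term ι)
    (ts : Fin n → (prodLanguage L L').Term ι) (v : ι → M) :
    (rightOpTerm f s ts).realize v = rightOp L f (s.realize v) fun i => (ts i).realize v := by
  rw [rightOpTerm, Term.realize_func, rightOp]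
  congr 1
  exact funext (Fin.cases rfl fun _ => rfl)

end Realize

/-- The translation of a term of the first signature. The variable `none` provides the second
coordinate of the value. -/
def leftTerm (L' : FirstOrder.Language.{u, 0}) :
    L.Term ℕ → (prodLanguage L L').Term (Option ℕ)
  | .var i => decTerm (.var (some i)) (.var none)
  | .func f ts => leftOpTerm f (.var none) fun i => leftTerm L' (ts i)

/-- The translation of a term of the second signature. The variable `none` provides the first
coordinate of the value. -/
def rightTerm (L : FirstOrder.Language.{u, 0}) :
    L'.Term ℕ → (prodLanguage L L').Term (Option ℕ)
  | .var i => decTerm (.var none) (.var (some i))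
  | .func f ts => rightOpTerm f (.var none) fun i => rightTerm L (ts i)

theorem realize_leftTerm {A B : Type u} [L.Structure A] [L'.Structure B] (t : L.Term ℕ)
    (v : Option ℕ → A × B) :
    (leftTerm L' t).realize v = (t.realize fun i => (v (some i)).1, (v none).2) := by
  induction t with
  | var i => simp [leftTerm, dec_prod]
  | func f ts ih => simp [leftTerm, leftOp_prod, ih]

theorem realize_rightTerm {A B : Type u} [L.Structure A] [L'.Structure B] (t : L'.Term ℕ)
    (v : Option ℕ → A × B) :
    (rightTerm L t).realize v = ((v none).1, t.realize fun i => (v (some i)).2) := by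
  induction t with
  | var i => simp [rightTerm, dec_prod]
  | func f ts ih => simp [rightTerm, rightOp_prod, ih]

end Translation

/-! ### Every algebra of the product variety is a non-indexed product -/

section Decomposition

variable {V V' : Variety.{u}} {M : Type u} [(prodLanguage V.L V'.L).Structure M]

theorem dec_self (hM : (V.prod V').Mem M) (x : M) : dec V.L V'.L x x = x := by
  have h : V.ProdValid V' (decTerm (.var 0) (.var 0)) (.var (0 : Fin 1)) := by
    intro A B _ _ _ _ v
    simp [dec_prod]
  simpa using h.realize_eq hM ![x]

theorem dec_dec_left (hM : (V.prod V').Mem M) (x y z : M) :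
    dec V.L V'.L (dec V.L V'.L x y) z = dec V.L V'.L x z := by
  have h : V.ProdValid V' (decTerm (decTerm (.var 0) (.var 1)) (.var 2))
      (decTerm (.var 0) (.var (2 : Fin 3))) := by
    intro A B _ _ _ _ v
    simp [dec_prod]
  simpa using h.realize_eq hM ![x, y, z]

theorem dec_dec_right (hM : (V.prod V').Mem M) (x y z : M) :
    dec V.L V'.L x (dec V.L V'.L y z) = dec V.L V'.L x z := by
  have h : V.ProdValid V' (decTerm (.var 0) (decTerm (.var 1) (.var 2)))
      (decTerm (.var 0) (.var (2 : Fin 3))) := by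
    intro A B _ _ _ _ v
    simp [dec_prod]
  simpa using h.realize_eq hM ![x, y, z]

/-- With `z = p` and the `x i` in the first factor, this says that the first factor is closed
under the operations of the first signature. -/
theorem dec_leftOp (hM : (V.prod V').Mem M) {n : ℕ} (f : V.L.Functions n) (p z : M)
    (x : Fin n → M) :
    dec V.L V'.L (leftOp V'.L f z x) p = leftOp V'.L f p fun i => dec V.L V'.L (x i) p := by
  have h : V.ProdValid V'
      (decTerm (leftOpTerm f (.var (Sum.inl 1)) fun i => .var (Sum.inr i)) (.var (Sum.inl 0)))
      (leftOpTerm f (.var (Sum.inl (0 : Fin 2)))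
        fun i => decTerm (.var (Sum.inr i)) (.var (Sum.inl 0))) := by
    intro A B _ _ _ _ v
    simp [dec_prod, leftOp_prod]
  simpa using h.realize_eq hM (Sum.elim ![p, z] x)

theorem dec_leftOp_right (hM : (V.prod V').Mem M) {n : ℕ} (f : V.L.Functions n) (p z : M)
    (x : Fin n → M) : dec V.L V'.L p (leftOp V'.L f z x) = dec V.L V'.L p z := by
  have h : V.ProdValid V'
      (decTerm (.var (Sum.inl 0)) (leftOpTerm f (.var (Sum.inl 1)) fun i => .var (Sum.inr i)))
      (decTerm (.var (Sum.inl (0 : Fin 2))) (.var (Sum.inl 1))) := by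
    intro A B _ _ _ _ v
    simp [dec_prod, leftOp_prod]
  simpa using h.realize_eq hM (Sum.elim ![p, z] x)

/-- With `z = p` and the `x i` in the second factor, this says that the second factor is closed
under the operations of the second signature. -/
theorem dec_rightOp (hM : (V.prod V').Mem M) {n : ℕ} (f : V'.L.Functions n) (p z : M)
    (x : Fin n → M) :
    dec V.L V'.L p (rightOp V.L f z x) = rightOp V.L f p fun i => dec V.L V'.L p (x i) := by
  have h : V.ProdValid V'
      (decTerm (.var (Sum.inl 0)) (rightOpTerm f (.var (Sum.inl 1)) fun i => .var (Sum.inr i)))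
      (rightOpTerm f (.var (Sum.inl (0 : Fin 2)))
        fun i => decTerm (.var (Sum.inl 0)) (.var (Sum.inr i))) := by
    intro A B _ _ _ _ v
    simp [dec_prod, rightOp_prod]
  simpa using h.realize_eq hM (Sum.elim ![p, z] x)

theorem dec_rightOp_left (hM : (V.prod V').Mem M) {n : ℕ} (f : V'.L.Functions n) (p z : M)
    (x : Fin n → M) : dec V.L V'.L (rightOp V.L f z x) p = dec V.L V'.L z p := by
  have h : V.ProdValid V'
      (decTerm (rightOpTerm f (.var (Sum.inl 1)) fun i => .var (Sum.inr i)) (.var (Sum.inl 0)))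
      (decTerm (.var (Sum.inl (1 : Fin 2))) (.var (Sum.inl 0))) := by
    intro A B _ _ _ _ v
    simp [dec_prod, rightOp_prod]
  simpa using h.realize_eq hM (Sum.elim ![p, z] x)

theorem leftTerm_eq (hM : (V.prod V').Mem M) {q : V.L.Term ℕ × V.L.Term ℕ} (hq : q ∈ V.eqs)
    (v : Option ℕ → M) : (leftTerm V'.L q.1).realize v = (leftTerm V'.L q.2).realize v := by
  have h : V.ProdValid V' (leftTerm V'.L q.1) (leftTerm V'.L q.2) := by
    intro A B _ _ hA _ w
    rw [realize_leftTerm, realize_leftTerm, hA.2 q hq]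
  exact h.realize_eq hM v

theorem rightTerm_eq (hM : (V.prod V').Mem M) {q : V'.L.Term ℕ × V'.L.Term ℕ}
    (hq : q ∈ V'.eqs) (v : Option ℕ → M) :
    (rightTerm V.L q.1).realize v = (rightTerm V.L q.2).realize v := by
  have h : V.ProdValid V' (rightTerm V.L q.1) (rightTerm V.L q.2) := by
    intro A B _ _ _ hB w
    rw [realize_rightTerm, realize_rightTerm, hB.2 q hq]
  exact h.realize_eq hM v

/-- The first factor of an algebra of the product variety, realized as the set of elements whose
second coordinate is that of the base point `p`. -/
def LeftFactor (V V' : Variety.{u}) {M : Type u} [(prodLanguage V.L V'.L).Structure M] (p : M) :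
    Type u :=
  {x : M // dec V.L V'.L x p = x}

/-- The second factor of an algebra of the product variety, realized as the set of elements whose
first coordinate is that of the base point `p`. -/
def RightFactor (V V' : Variety.{u}) {M : Type u} [(prodLanguage V.L V'.L).Structure M] (p : M) :
    Type u :=
  {x : M // dec V.L V'.L p x = x}

/-- The operations of the first factor use the base point as the additional argument. -/
abbrev leftFactorStructure (hM : (V.prod V').Mem M) (p : M) :
    V.L.Structure (LeftFactor V V' p) where
  funMap f x := ⟨leftOp V'.L f p fun i => (x i).1, by
    rw [dec_leftOp hM]; simp only [(x _).2]⟩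
  RelMap _ _ := False

/-- The operations of the second factor use the base point as the additional argument. -/
abbrev rightFactorStructure (hM : (V.prod V').Mem M) (p : M) :
    V'.L.Structure (RightFactor V V' p) where
  funMap f x := ⟨rightOp V.L f p fun i => (x i).1, by
    rw [dec_rightOp hM]; simp only [(x _).2]⟩
  RelMap _ _ := False

theorem leftFactor_mem (hM : (V.prod V').Mem M) (p : M) :
    letI := leftFactorStructure hM p
    V.Mem (LeftFactor V V' p) := by
  let := leftFactorStructure hM p
  refine ⟨⟨⟨p, dec_self hM p⟩⟩, fun q hq v => Subtype.ext ?_⟩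
  have key (t : V.L.Term ℕ) : (t.realize v).1 =
      (leftTerm V'.L t).realize fun o : Option ℕ => o.elim p fun i => (v i).1 := by
    induction t with
    | var i => simpa [leftTerm] using (v i).2.symm
    | func f ts ih =>
      simp only [leftTerm, realize_leftOpTerm, ← ih]
      rfl
  rw [key, key, leftTerm_eq hM hq]

theorem rightFactor_mem (hM : (V.prod V').Mem M) (p : M) :
    letI := rightFactorStructure hM p
    V'.Mem (RightFactor V V' p) := by
  let := rightFactorStructure hM p
  refine ⟨⟨⟨p, dec_self hM p⟩⟩, fun q hq v => Subtype.ext ?_⟩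
  have key (t : V'.L.Term ℕ) : (t.realize v).1 =
      (rightTerm V.L t).realize fun o : Option ℕ => o.elim p fun i => (v i).1 := by
    induction t with
    | var i => simpa [rightTerm] using (v i).2.symm
    | func f ts ih =>
      simp only [rightTerm, realize_rightOpTerm, ← ih]
      rfl
  rw [key, key, rightTerm_eq hM hq]

/-- An algebra of the product variety is in bijection with the product of its factors. -/
def factorEquiv (hM : (V.prod V').Mem M) (p : M) :
    M ≃ LeftFactor V V' p × RightFactor V V' p where
  toFun x := (⟨dec V.L V'.L x p, dec_dec_left hM x p p⟩,
    ⟨dec V.L V'.L p x, dec_dec_right hM p p x⟩)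
  invFun y := dec V.L V'.L y.1.1 y.2.1
  left_inv x := by simp only [dec_dec_left hM, dec_dec_right hM, dec_self hM]
  right_inv y := by
    refine Prod.ext (Subtype.ext ?_) (Subtype.ext ?_)
    · exact (dec_dec_left hM _ _ _).trans y.1.2
    · exact (dec_dec_right hM _ _ _).trans y.2.2

theorem isDecomposition_factorEquiv (hM : (V.prod V').Mem M) (p : M) :
    letI := leftFactorStructure hM p
    letI := rightFactorStructure hM p
    IsDecomposition V.L V'.L (factorEquiv hM p) := by
  let := leftFactorStructure hM p
  let := rightFactorStructure hM p
  refine ⟨fun x => ?_, fun f x => ?_, fun f x => ?_⟩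
  · have hx : funMap (L := prodLanguage V.L V'.L) ProdFun.dec x = dec V.L V'.L (x 0) (x 1) := by
      rw [dec]; congr 1; exact funext (Fin.forall_fin_two.2 ⟨rfl, rfl⟩)
    rw [hx]
    exact Prod.ext (Subtype.ext (dec_dec_left hM _ _ _)) (Subtype.ext (dec_dec_right hM _ _ _))
  · have hx : funMap (L := prodLanguage V.L V'.L) (ProdFun.left f) x =
        leftOp V'.L f (x 0) fun i => x i.succ := by
      rw [leftOp]; congr 1; exact (Fin.cons_self_tail x).symm
    rw [hx]
    exact Prod.ext (Subtype.ext (dec_leftOp hM _ _ _ _)) (Subtype.ext (dec_leftOp_right hM _ _ _ _))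
  · have hx : funMap (L := prodLanguage V.L V'.L) (ProdFun.right f) x =
        rightOp V.L f (x 0) fun i => x i.succ := by
      rw [rightOp]; congr 1; exact (Fin.cons_self_tail x).symm
    rw [hx]
    exact Prod.ext (Subtype.ext (dec_rightOp_left hM _ _ _ _))
      (Subtype.ext (dec_rightOp hM _ _ _ _))

theorem prod_exists_decomposition (hM : (V.prod V').Mem M) :
    ∃ (A B : Type u) (_ : V.L.Structure A) (_ : V'.L.Structure B) (e : M ≃ A × B),
      V.Mem A ∧ V'.Mem B ∧ IsDecomposition V.L V'.L e :=
  have p := hM.1.some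
  ⟨_, _, leftFactorStructure hM p, rightFactorStructure hM p, factorEquiv hM p,
    leftFactor_mem hM p, rightFactor_mem hM p, isDecomposition_factorEquiv hM p⟩

end Decomposition

theorem CongruenceModular.prod {V V' : Variety.{u}} (hV : V.CongruenceModular)
    (hV' : V'.CongruenceModular) : (V.prod V').CongruenceModular := by
  intro M _ hM
  obtain ⟨A, B, _, _, e, hA, hB, hd⟩ := prod_exists_decomposition hM
  have := hV A hA
  have := hV' B hB
  have := hM.1
  exact hd.isModularLattice

/-! ### Spectra of the product variety -/

/-- The one-element algebra satisfies all equations. So an inclusion that holds in all products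
can be tested on each factor separately. -/
theorem exists_mem (V : Variety.{u}) : ∃ (A : Type u) (_ : V.L.Structure A), V.Mem A :=
  ⟨PUnit, { funMap := fun _ _ => ⟨⟩, RelMap := fun _ _ => False }, ⟨⟨⟨⟩⟩, fun _ _ _ => rfl⟩⟩

theorem bounds_prod (V V' : Variety.{u}) (s : Spec) (x : s.Arg) :
    (V.prod V').bounds s x = V.bounds s x ∩ V'.bounds s x := by
  ext k
  constructor
  · intro h
    have key (A B : Type u) [V.L.Structure A] [V'.L.Structure B] (hA : V.Mem A)
        (hB : V'.Mem B) : s.HoldsIn V.L A x k ∧ s.HoldsIn V'.L B x k :=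
      have := hA.1
      have := hB.1
      ((isDecomposition_refl V.L V'.L A B).holdsIn_iff s x k).1 (h (A × B) (prod_mem V V' hA hB))
    constructor
    · intro A _ hA
      obtain ⟨B, _, hB⟩ := V'.exists_mem
      exact (key A B hA hB).1
    · intro B _ hB
      obtain ⟨A, _, hA⟩ := V.exists_mem
      exact (key A B hA hB).2
  · rintro ⟨h, h'⟩ M _ hM
    obtain ⟨A, B, _, _, e, hA, hB, hd⟩ := prod_exists_decomposition hM
    have := hA.1
    have := hB.1
    exact (hd.holdsIn_iff s x k).2 ⟨h A hA, h' B hB⟩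

/-- The bounds form an upward closed set, as the right-hand sides increase with `k`. -/
theorem spectrum_le_natCast_iff (V : Variety.{u}) (s : Spec) (x : s.Arg) (n : ℕ) :
    V.spectrum s x ≤ n ↔ n ∈ V.bounds s x := by
  constructor
  · intro h
    have hlt : V.spectrum s x < (n + 1 : ℕ) := h.trans_lt (by exact_mod_cast n.lt_succ_self)
    simp only [spectrum, iInf_lt_iff, Nat.cast_lt] at hlt
    obtain ⟨k, hk, hkn⟩ := hlt
    exact Nat.le_induction hk (fun m _ hm A _ hA => (hm A hA).succ) n (Nat.lt_succ_iff.1 hkn)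
  · exact fun h => iInf₂_le n h

theorem spectrum_prod (V V' : Variety.{u}) (s : Spec) (x : s.Arg) :
    (V.prod V').spectrum s x = max (V.spectrum s x) (V'.spectrum s x) := by
  have key (n : ℕ) : (V.prod V').spectrum s x ≤ n ↔
      max (V.spectrum s x) (V'.spectrum s x) ≤ n := by
    rw [max_le_iff, spectrum_le_natCast_iff, spectrum_le_natCast_iff, spectrum_le_natCast_iff,
      bounds_prod, Set.mem_inter_iff]
  exact WithTop.eq_of_forall_le_coe_iff key

end Variety
end UnivAlg

theorem proposition7p2 :
    -- closure of the realizable functions under pointwise maximum, spectrum by spectrum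
    (∀ s : UnivAlg.Spec, ∀ f ∈ UnivAlg.realizable.{u} s, ∀ g ∈ UnivAlg.realizable.{u} s,
      (fun x => max (f x) (g x)) ∈ UnivAlg.realizable.{u} s) ∧
    -- the same in detail, with one variety for all the spectra
    (∀ V V' : UnivAlg.Variety.{u}, V.CongruenceModular → V'.CongruenceModular →
      ∃ W : UnivAlg.Variety.{u}, W.CongruenceModular ∧
        ∀ (s : UnivAlg.Spec) (x : s.Arg),
          W.spectrum s x = max (V.spectrum s x) (V'.spectrum s x)) ∧
    -- closure of the realizable 13-tuples under componentwise maximum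
    (∀ f ∈ UnivAlg.realizableTuples.{u}, ∀ g ∈ UnivAlg.realizableTuples.{u},
      (fun s x => max (f s x) (g s x)) ∈ UnivAlg.realizableTuples.{u}) := by
  refine ⟨?_, fun V V' hV hV' => ⟨V.prod V', hV.prod hV', V.spectrum_prod V'⟩, ?_⟩
  · rintro s f ⟨V, hV, hf⟩ g ⟨V', hV', hg⟩
    refine ⟨V.prod V', hV.prod hV', fun x => ?_⟩
    rw [V.spectrum_prod V', hf, hg]
    exact (Nat.mono_cast (α := ℕ∞)).map_max
  · rintro f ⟨V, hV, hf⟩ g ⟨V', hV', hg⟩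
    refine ⟨V.prod V', hV.prod hV', fun s x => ?_⟩
    rw [V.spectrum_prod V', hf, hg]
    exact (Nat.mono_cast (α := ℕ∞)).map_max
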